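/- Let $B$ be a compact operator on a complex Hilbert space $\mathfrak H$ whose numerical range $\Theta(B)=\{(Bf,f):\|f\|=1\}$ lies in the closed sector $\mathfrak L_0(\theta)=\{z\in\mathbb C: |\arg z|\le\theta\}$ (which contains its vertex $0$), where $0\le\theta<\pi$. Let $\varsigma>0$ with $\theta+\varsigma<\pi$, and let $r>0$ be such that $(I-\lambda B)^{-1}$ exists as a bounded operator for all $|\lambda|\le r$. Put $$\vartheta(B)=\{\lambda:|\lambda|=r,\ |\arg\lambda|\le\theta+\varsigma\}\cup\{\lambda:|\lambda|>r,\ |\arg\lambda|=\theta+\varsigma\},$$ $$\mathrm{int}\,\vartheta(B)=\{\lambda:|\lambda|>r,\ |\arg\lambda|<\theta+\varsigma\},$$ where the contour is run through from infinity along the lower ray, counterclockwise along the arc, and to infinity along the upper ray. Let $\varphi$ be a nonconstant entire function of order less than $1/2$, where the order is the infimum of all $k>0$ such that $\max_{|z|=\rho}|\varphi(z)|<e^{\rho^k}$ for all sufficiently large $\rho$. Suppose that there are $\varpi<\pi/2$ and $R_0$ such that $\varphi(z)\in\mathfrak L_0(\varpi)$ for all $z\in\mathrm{int}\,\vartheta(B)$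 with $|z|>R_0$. Then $(I-\lambda B)^{-1}$ exists as a bounded operator for all $\lambda\in\vartheta(B)$, and for every $f\in\mathrm R(B)$ (the range of $B$) the improper integral $$u(t)=\frac1{2\pi i}\int_{\vartheta(B)}e^{-\varphi(\lambda)t}B(I-\lambda B)^{-1}f\,d\lambda$$ converges for every $t>0$, and $u(t)\to f$ as $t\to+0$. -/

import Mathlib

open Filter Topology

namespace AbelLidskii

/-- The numerical range of a bounded operator, the set of all `(B f, f)` with `‖f‖ = 1`, where
the inner product `(g, f)` is linear in `g`, that is `(g, f) = inner ℂ f g` in Mathlib. -/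
def numericalRange {H : Type*} [NormedAddCommGroup H] [InnerProductSpace ℂ H]
    (B : H →L[ℂ] H) : Set ℂ :=
  {z | ∃ f : H, ‖f‖ = 1 ∧ z = inner ℂ f (B f)}

/-- The closed sector with vertex `0` and semi-angle `θ`. It contains its vertex, because
`Complex.arg 0 = 0`, as soon as `0 ≤ θ`. -/
def sector (θ : ℝ) : Set ℂ :=
  {z | |Complex.arg z| ≤ θ}

/-- The contour made of the arc `|z| = r`, `|arg z| ≤ α` and of the two rays
`|z| > r`, `|arg z| = α`. -/
def contour (r α : ℝ) : Set ℂ :=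
  {z | ‖z‖ = r ∧ |Complex.arg z| ≤ α} ∪ {z | r < ‖z‖ ∧ |Complex.arg z| = α}

/-- The inside of the contour `contour r α`. -/
def contourInterior (r α : ℝ) : Set ℂ :=
  {z | r < ‖z‖ ∧ |Complex.arg z| < α}

/-- The integral of `F` over the part of `contour r α` on which `|z| ≤ R₁` on the lower ray and
`|z| ≤ R₂` on the upper ray. The contour is run through from the far end of the lower ray to the
arc, counterclockwise along the arc, and out along the upper ray. -/
noncomputable def truncatedContourIntegral {E : Type*} [NormedAddCommGroup E] [NormedSpace ℂ E]
    (r α R₁ R₂ : ℝ) (F : ℂ → E) : E :=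
  (∫ s in R₁..r, Complex.exp (-(α * Complex.I)) • F (s * Complex.exp (-(α * Complex.I))))
    + (∫ x in (-α)..α,
        (r * Complex.exp (x * Complex.I) * Complex.I) • F (r * Complex.exp (x * Complex.I)))
    + ∫ s in r..R₂, Complex.exp (α * Complex.I) • F (s * Complex.exp (α * Complex.I))

/-- The improper integral of `F` over `contour r α` converges and has the value `v`. The two
rays are truncated independently of each other. -/
def HasContourIntegral {E : Type*} [NormedAddCommGroup E] [NormedSpace ℂ E]
    (r α : ℝ) (F : ℂ → E) (v : E) : Prop :=
  Tendsto (fun R : ℝ × ℝ => truncatedContourIntegral r α R.1 R.2 F) (atTop ×ˢ atTop) (𝓝 v)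

/-- The maximum modulus of `φ` on the circle `|z| = r`. -/
noncomputable def maxModulus (φ : ℂ → ℂ) (r : ℝ) : ℝ :=
  sSup ((fun z : ℂ => ‖φ z‖) '' Metric.sphere 0 r)

/-- The order of an entire function: the greatest lower bound of the numbers `k > 0` such that
`max_{|z| = r} |φ z| < exp (r ^ k)` for all sufficiently large `r`
(it is `⊤` if there is no such `k`). -/
noncomputable def entireOrder (φ : ℂ → ℂ) : EReal :=
  ⨅ k ∈ {k : ℝ | 0 < k ∧ ∀ᶠ r : ℝ in atTop, maxModulus φ r < Real.exp (r ^ k)}, (k : EReal)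

end AbelLidskii

/-!
Write `f = B g` and `α = θ + ς`. Three facts carry the proof.

* **The function `φ` is a polynomial.** Near infinity in the sector, `φ` has nonnegative real part;
  the Harnack inequality, applied on discs that grow with the distance to the origin, gives
  polynomial growth on the positive half-axis (`exists_pow_bound_on_ray`). The plane slit along this
  half-axis has opening `2 * π`, for which the Phragmén–Lindelöf principle needs just order less
  than `1 / 2`, so the growth is polynomial everywhere (`exists_pow_bound_of_ray`), and `φ` is a
  polynomial by Liouville's theorem. Being nonconstant, it satisfies `Re φ z ≥ c * ‖z‖ - M` with
  `c > 0` in the closed sector `|arg z| ≤ α` (`exists_linear_lower_bound_re`).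
* **The resolvent is bounded outside the sector.** For `α ≤ arg z ≤ 2 * π - α` the numerical range
  of `1 - z B` stays at a distance at least `sin ς` from `0`, so `‖(1 - z B)⁻¹‖ ≤ 1 / sin ς`
  (`isUnit_one_sub_smul`, `norm_inverse_one_sub_smul_le`). Since
  `B (1 - z B)⁻¹ B g = -z⁻¹ f + z⁻² ((1 - z B)⁻¹ g - g)`, the kernel
  `K z = B (1 - z B)⁻¹ f + z⁻¹ f` is `O(‖z‖⁻²)` there.
* **The contour can be closed on either side.** The integral of `exp (-φ z * t) z⁻¹ f` is zero: this
  function is holomorphic and rapidly decreasing inside the contour, where the poles of the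
  resolvent play no role (`contourIntegral_eq_zero`). As `t → +0`, dominated convergence replaces
  `exp (-φ z * t) K z` by `K z`, whose integral is computed by closing the contour on the other
  side, where `K` is holomorphic except for the pole `z⁻¹ f` at the origin
  (`contourIntegral_eq_circleIntegral`, `circleIntegral_resolventKernel`). The result is `2 π i f`.
-/

/-! ### Entire functions of order less than one half that map a sector into a sector -/

namespace AbelLidskii

lemma norm_le_maxModulus {φ : ℂ → ℂ} (hφ : Continuous φ) (z : ℂ) :
    ‖φ z‖ ≤ maxModulus φ ‖z‖ := by
  refine le_csSup ((isCompact_sphere 0 _).image hφ.norm).bddAbove ⟨z, by simp, rfl⟩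

lemma exists_exponent_of_entireOrder_lt {φ : ℂ → ℂ} (hφ : Continuous φ) {ρ : ℝ}
    (h : entireOrder φ < (ρ : EReal)) :
    ∃ k : ℝ, 0 < k ∧ k < ρ ∧ ∃ R₁ : ℝ, ∀ z : ℂ, R₁ ≤ ‖z‖ → ‖φ z‖ ≤ Real.exp (‖z‖ ^ k) := by
  unfold entireOrder at h
  simp only [iInf_lt_iff] at h
  obtain ⟨k, ⟨hk0, hk⟩, hkρ⟩ := h
  obtain ⟨R₁, hR₁⟩ := eventually_atTop.1 hk
  exact ⟨k, hk0, by exact_mod_cast hkρ, R₁, fun z hz =>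
    (norm_le_maxModulus hφ z).trans (hR₁ _ hz).le⟩

/-- A Harnack inequality for holomorphic functions with nonnegative real part. -/
lemma norm_le_three_mul_of_re_nonneg {φ : ℂ → ℂ} (hφ : Differentiable ℂ φ) {c : ℂ} {ρ : ℝ}
    (hρ : 0 < ρ) (hre : ∀ z ∈ Metric.ball c ρ, 0 ≤ (φ z).re) {z : ℂ} (hz : ‖z - c‖ ≤ ρ / 2) :
    ‖φ z‖ ≤ 3 * ‖φ c‖ := by
  refine le_of_forall_pos_le_add fun ε hε => ?_
  have key := Complex.borelCaratheodory (f := fun w => -φ (c + w)) (z := z - c) (R := ρ)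
    (half_pos hε) (by fun_prop) (fun w hw => ?_) hρ (by
      rw [mem_ball_zero_iff]; linarith)
  · simp only [norm_neg, add_sub_cancel, add_zero] at key
    have h1 : 2 * (ε / 2) * ‖z - c‖ / (ρ - ‖z - c‖) ≤ ε := by
      rw [div_le_iff₀ (by linarith)]; nlinarith
    have h2 : ‖φ c‖ * (ρ + ‖z - c‖) / (ρ - ‖z - c‖) ≤ 3 * ‖φ c‖ := by
      rw [div_le_iff₀ (by linarith)]; nlinarith [norm_nonneg (φ c)]
    linarith
  · have : 0 ≤ (φ (c + w)).re := hre _ (by simpa using hw)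
    simp only [Set.mem_ofPred_eq, Complex.neg_re]
    linarith

/-- A function on a half-line that grows by at most a fixed factor when its argument is multiplied
by some `q > 1` has polynomial growth. -/
lemma exists_pow_bound_of_scaling {h : ℝ → ℝ} {q x₀ C : ℝ} (hq : 1 < q) (hx₀ : 0 < x₀)
    (hh : ∀ x, 0 ≤ h x)
    (hs : ∀ x, x₀ ≤ x → ∀ y, x ≤ y → y ≤ q * x → h y ≤ C * h x) :
    ∃ N : ℕ, ∃ A : ℝ, ∀ y, x₀ ≤ y → h y ≤ A * y ^ N := by
  -- with `C ≤ q ^ N`, the bound `h ≤ A * y ^ N` is inherited from `y / q` by `y`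
  obtain ⟨N, hN⟩ := pow_unbounded_of_one_lt C hq
  refine ⟨N, |C| * h x₀ / x₀ ^ N, ?_⟩
  have hA : 0 ≤ |C| * h x₀ / x₀ ^ N := by have := hh x₀; positivity
  have step : ∀ n : ℕ, ∀ y, x₀ ≤ y → y ≤ q ^ n * (q * x₀) →
      h y ≤ |C| * h x₀ / x₀ ^ N * y ^ N := by
    intro n
    induction n with
    | zero =>
      intro y h1 h2
      calc h y ≤ C * h x₀ := hs x₀ le_rfl y h1 (by simpa using h2)
        _ ≤ |C| * h x₀ := by gcongr; exacts [hh _, le_abs_self _]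
        _ = |C| * h x₀ / x₀ ^ N * x₀ ^ N := by field_simp
        _ ≤ _ := by gcongr
    | succ n ih =>
      intro y h1 h2
      by_cases hy : y ≤ q ^ n * (q * x₀)
      · exact ih y h1 hy
      have hq0 : 0 < q := by linarith
      have hle : x₀ ≤ y / q := by
        rw [le_div_iff₀ hq0]
        have : 1 ≤ q ^ n := one_le_pow₀ hq.le
        nlinarith [mul_pos hq0 hx₀]
      have h3 := ih (y / q) hle (by rw [div_le_iff₀ hq0]; rw [pow_succ] at h2; linarith)
      have h4 := hs (y / q) hle y (div_le_self (by linarith) hq.le) (by field_simp; exact le_rfl)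
      calc h y ≤ C * h (y / q) := h4
        _ ≤ q ^ N * h (y / q) := by gcongr; exact hh _
        _ ≤ q ^ N * (|C| * h x₀ / x₀ ^ N * (y / q) ^ N) := by gcongr
        _ = _ := by rw [div_pow]; field_simp
  intro y hy
  obtain ⟨n, hn⟩ := pow_unbounded_of_one_lt (y / (q * x₀)) hq
  exact step n y hy ((div_lt_iff₀ (by positivity)).1 hn).le

/-- If `Re φ ≥ 0` far out in a sector around the positive half-axis, then `φ` has polynomial growth
on that half-axis: discs about `x` of radius `δ * x` stay in the sector, and the Harnack inequality
on them bounds `φ` on `[x, (1 + δ / 2) * x]` by `3 * ‖φ x‖`. -/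
lemma exists_pow_bound_on_ray {φ : ℂ → ℂ} (hφ : Differentiable ℂ φ) {α R : ℝ} (hα : 0 < α)
    (hre : ∀ z : ℂ, R < ‖z‖ → |z.arg| < α → 0 ≤ (φ z).re) :
    ∃ N : ℕ, ∃ A : ℝ, 0 ≤ A ∧ ∀ x : ℝ, 0 ≤ x → ‖φ x‖ ≤ A * (1 + x) ^ N := by
  -- a disc about `1` lying in the sector
  obtain ⟨δ, hδ0, hδ⟩ : ∃ δ > 0, ∀ w : ℂ, ‖w - 1‖ < δ → ‖w‖ > 1 / 2 ∧ |w.arg| < α := by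
    have h1 : ∀ᶠ w : ℂ in 𝓝 1, |w.arg| < α :=
      (Complex.continuousAt_arg (by simp)).abs.eventually_lt_const (by simpa)
    have h2 : ∀ᶠ w : ℂ in 𝓝 1, 1 / 2 < ‖w‖ :=
      continuous_norm.continuousAt.eventually_const_lt (by norm_num)
    obtain ⟨δ, h, h'⟩ := Metric.eventually_nhds_iff.1 (h2.and h1)
    exact ⟨δ, h, fun w hw => h' (by rwa [dist_eq_norm])⟩
  have hx₀ : 0 < 2 * |R| + 1 := by positivity
  obtain ⟨N, A, hA⟩ := exists_pow_bound_of_scaling (h := fun x : ℝ => ‖φ x‖) (q := 1 + δ / 2)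
    (x₀ := 2 * |R| + 1) (C := 3) (by linarith) hx₀ (fun _ => norm_nonneg _) (by
      intro x hx y hxy hyq
      have hx0 : 0 < x := hx₀.trans_le hx
      refine norm_le_three_mul_of_re_nonneg hφ (ρ := δ * x) (by positivity) (fun z hz => ?_) ?_
      · have hzx : z = (x : ℂ) * (z / x) := by
          have : (x : ℂ) ≠ 0 := by exact_mod_cast hx0.ne'
          field_simp
        have hw : ‖z / x - 1‖ < δ := by
          have : (x : ℂ) ≠ 0 := by exact_mod_cast hx0.ne'
          rw [div_sub_one this, norm_div, Complex.norm_real, Real.norm_of_nonneg hx0.le,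
            div_lt_iff₀ hx0]
          simpa [dist_eq_norm] using hz
        obtain ⟨hw1, hw2⟩ := hδ _ hw
        apply hre
        · rw [hzx, norm_mul, Complex.norm_real, Real.norm_of_nonneg hx0.le]
          have := le_abs_self R
          nlinarith
        · rw [hzx, Complex.arg_real_mul _ hx0]
          exact hw2
      · rw [← Complex.ofReal_sub, Complex.norm_real, Real.norm_of_nonneg (by linarith)]
        linarith)
  obtain ⟨C, hC⟩ := (isCompact_Icc (a := (0 : ℝ)) (b := 2 * |R| + 1)).exists_bound_of_continuousOn
    (f := fun x : ℝ => φ x) (by have := hφ.continuous; fun_prop)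
  refine ⟨N, max |A| |C|, by positivity, fun x hx => ?_⟩
  by_cases hxx : 2 * |R| + 1 ≤ x
  · calc ‖φ x‖ ≤ A * x ^ N := hA x hxx
      _ ≤ max |A| |C| * (1 + x) ^ N := by
        gcongr
        · exact (le_abs_self A).trans (le_max_left _ _)
        · linarith
  · calc ‖φ x‖ ≤ C := hC x ⟨hx, by linarith⟩
      _ ≤ max |A| |C| * 1 := by rw [mul_one]; exact (le_abs_self C).trans (le_max_right _ _)
      _ ≤ max |A| |C| * (1 + x) ^ N := by
        gcongr
        exact one_le_pow₀ (by linarith)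

lemma exists_closed_quadrant_fourth_root (w : ℂ) : ∃ z : ℂ, 0 ≤ z.re ∧ 0 ≤ z.im ∧ z ^ 4 = w := by
  obtain ⟨z, hz⟩ := IsAlgClosed.exists_pow_nat_eq w (n := 4) (by norm_num)
  have hI : Complex.I ^ 4 = 1 := Complex.I_pow_four
  rcases le_total 0 z.re with h1 | h1 <;> rcases le_total 0 z.im with h2 | h2
  · exact ⟨z, h1, h2, hz⟩
  · exact ⟨Complex.I * z, by simpa, by simpa, by rw [mul_pow, hI, hz, one_mul]⟩
  · exact ⟨-(Complex.I * z), by simpa, by simpa, by rw [neg_pow, mul_pow, hI, hz]; norm_num⟩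
  · exact ⟨-z, by simpa, by simpa, by rw [neg_pow, hz]; norm_num⟩

/-- An entire function of order less than `1 / 2` with polynomial growth on the positive half-axis
has polynomial growth in the whole plane. The fourth power maps the open first quadrant onto the
plane slit along the closed positive half-axis (and its two sides to that half-axis), so that
`φ (z ^ 4) / (1 + z) ^ (4 * N)` satisfies the hypotheses of the Phragmén–Lindelöf principle in the
quadrant: its growth exponent is `4 * k < 2`. -/
lemma exists_pow_bound_of_ray {φ : ℂ → ℂ} (hφ : Differentiable ℂ φ) {k : ℝ} (hk0 : 0 < k)
    (hk : k < 1 / 2) {R₁ : ℝ} (hR₁ : ∀ z : ℂ, R₁ ≤ ‖z‖ → ‖φ z‖ ≤ Real.exp (‖z‖ ^ k))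
    {N : ℕ} {A : ℝ} (hA0 : 0 ≤ A) (hA : ∀ x : ℝ, 0 ≤ x → ‖φ x‖ ≤ A * (1 + x) ^ N) (w : ℂ) :
    ‖φ w‖ ≤ A * (2 * (1 + ‖w‖)) ^ (4 * N) := by
  obtain ⟨z, hzr, hzi, rfl⟩ := exists_closed_quadrant_fourth_root w
  have hge : ∀ z : ℂ, 0 ≤ z.re → 1 ≤ ‖1 + z‖ := fun z hz => by
    have h := Complex.re_le_norm (1 + z)
    simp at h; linarith
  have hne : ∀ z : ℂ, 0 ≤ z.re → 1 + z ≠ 0 := fun z hz => by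
    rw [← norm_pos_iff]; linarith [hge z hz]
  have key := PhragmenLindelof.quadrant_I (f := fun z => φ (z ^ 4) / (1 + z) ^ (4 * N)) (C := A)
    (z := z) ?_ ?_ ?_ ?_ hzr hzi
  · rw [norm_div, norm_pow, div_le_iff₀ (by have := hge z hzr; positivity)] at key
    refine key.trans ?_
    gcongr
    have h1 : ‖1 + z‖ ≤ 1 + ‖z‖ := by simpa using norm_add_le 1 z
    have h2 : ‖z‖ ≤ 1 + ‖z ^ 4‖ := by
      rw [norm_pow]
      nlinarith [sq_nonneg (‖z‖ ^ 2 - 1), sq_nonneg (‖z‖ - 1), sq_nonneg (‖z‖^2)]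
    linarith [norm_nonneg (z ^ 4)]
  · apply DifferentiableOn.diffContOnCl
    intro z hz
    have hz' : 0 ≤ z.re := by
      have : closure (Set.Ioi (0 : ℝ) ×ℂ Set.Ioi 0) ⊆ {z : ℂ | 0 ≤ z.re} :=
        closure_minimal (fun z hz => (le_of_lt hz.1 : 0 ≤ z.re))
          (isClosed_le continuous_const Complex.continuous_re)
      exact this hz
    have h1 : DifferentiableAt ℂ (fun z => φ (z ^ 4)) z := by fun_prop
    have h2 : DifferentiableAt ℂ (fun z : ℂ => (1 + z) ^ (4 * N)) z := by fun_prop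
    exact (h1.div h2 (pow_ne_zero _ (hne z hz'))).differentiableWithinAt
  · refine ⟨4 * k, by linarith, 1, ?_⟩
    refine Asymptotics.IsBigO.of_bound 1 ?_
    have hlarge : ∀ᶠ z : ℂ in Bornology.cobounded ℂ, max 1 |R₁| ≤ ‖z‖ :=
      tendsto_norm_cobounded_atTop.eventually_ge_atTop _
    filter_upwards [hlarge.filter_mono inf_le_left,
      mem_inf_of_right (mem_principal_self _)] with z hz hzq
    have h1 : 1 ≤ ‖1 + z‖ := hge z (le_of_lt hzq.1)
    have h2 : R₁ ≤ ‖z ^ 4‖ := by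
      rw [norm_pow]
      calc R₁ ≤ ‖z‖ := (le_abs_self _).trans ((le_max_right _ _).trans hz)
        _ ≤ _ := le_self_pow₀ ((le_max_left _ _).trans hz) (by norm_num)
    rw [norm_div, norm_pow, one_mul, one_mul, Real.norm_of_nonneg (Real.exp_pos _).le]
    refine (div_le_self (norm_nonneg _) (one_le_pow₀ h1)).trans ((hR₁ _ h2).trans ?_)
    rw [norm_pow, Real.rpow_mul (norm_nonneg _)]
    exact_mod_cast le_rfl
  · intro x hx
    have h1 : ‖1 + (x : ℂ)‖ = 1 + x := by
      rw [← Complex.ofReal_one, ← Complex.ofReal_add, Complex.norm_real,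
        Real.norm_of_nonneg (by linarith)]
    rw [norm_div, norm_pow, h1, div_le_iff₀ (by positivity)]
    have := hA (x ^ 4) (by positivity)
    rw [Complex.ofReal_pow] at this
    refine this.trans ?_
    rw [pow_mul]
    gcongr
    nlinarith [pow_nonneg hx 2, pow_nonneg hx 3]
  · intro x hx
    have h1 : ‖1 + (x : ℂ) * Complex.I‖ ^ 2 = 1 + x ^ 2 := by
      rw [Complex.sq_norm, Complex.normSq_apply]; simp; ring
    have h2 : 1 + x ^ 4 ≤ ‖1 + (x : ℂ) * Complex.I‖ ^ 4 := by
      rw [show ‖1 + (x : ℂ) * Complex.I‖ ^ 4 = (‖1 + (x : ℂ) * Complex.I‖ ^ 2) ^ 2 by ring, h1]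
      nlinarith [sq_nonneg x]
    have h3 : ((x : ℂ) * Complex.I) ^ 4 = (x ^ 4 : ℝ) := by
      rw [mul_pow, Complex.I_pow_four]; simp
    have h4 : 0 < 1 + x ^ 4 := by positivity
    rw [norm_div, norm_pow, h3, div_le_iff₀ (by
      have : 0 < ‖1 + (x : ℂ) * Complex.I‖ := norm_pos_iff.2 (hne _ (by simp))
      positivity)]
    refine (hA (x ^ 4) (by positivity)).trans ?_
    rw [pow_mul]
    gcongr

/-- **Liouville's theorem** for polynomial growth: Cauchy's estimates annihilate all Taylor
coefficients of high order. -/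
lemma exists_polynomial_of_pow_bound {φ : ℂ → ℂ} (hφ : Differentiable ℂ φ) {A : ℝ} {n : ℕ}
    (h : ∀ z, ‖φ z‖ ≤ A * (2 * (1 + ‖z‖)) ^ n) : ∃ p : Polynomial ℂ, ∀ z, φ z = p.eval z := by
  have hder : ∀ m, n < m → iteratedDeriv m φ 0 = 0 := by
    intro m hm
    obtain ⟨d, rfl⟩ := Nat.exists_eq_add_of_lt hm
    have hle : ∀ᶠ R : ℝ in atTop, ‖iteratedDeriv (n + d + 1) φ 0‖ ≤
        ((n + d + 1).factorial * A * 4 ^ n) / R := by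
      filter_upwards [eventually_ge_atTop 1] with R hR
      have hR0 : 0 < R := by linarith
      refine (Complex.norm_iteratedDeriv_le_of_forall_mem_sphere_norm_le (n + d + 1) hR0
        hφ.diffContOnCl (C := A * (2 * (1 + R)) ^ n) fun z hz => ?_).trans ?_
      · simpa [mem_sphere_zero_iff_norm.1 hz] using h z
      · have hA : 0 ≤ A := by
          have := (norm_nonneg _).trans (h 0)
          simp at this
          exact this
        rw [div_le_div_iff₀ (by positivity) hR0]
        have h4 : 2 * (1 + R) ≤ 4 * R := by linarith
        calc ((n + d + 1).factorial * (A * (2 * (1 + R)) ^ n)) * R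
            ≤ ((n + d + 1).factorial * (A * (4 * R) ^ n)) * R := by gcongr
          _ = ((n + d + 1).factorial * A * 4 ^ n) * (R ^ (n + 1)) := by rw [mul_pow]; ring
          _ ≤ _ := by
            gcongr
            omega
    have h0 : ‖iteratedDeriv (n + d + 1) φ 0‖ ≤ 0 :=
      ge_of_tendsto (tendsto_const_nhds.div_atTop tendsto_id) hle
    exact norm_le_zero_iff.1 h0
  refine ⟨∑ m ∈ Finset.range (n + 1),
    Polynomial.C ((m.factorial : ℂ)⁻¹ * iteratedDeriv m φ 0) * Polynomial.X ^ m, fun z => ?_⟩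
  rw [← Complex.taylorSeries_eq_of_entire' 0 z hφ, tsum_eq_sum (s := Finset.range (n + 1))]
  · simp [Polynomial.eval_finsetSum]
  · intro m hm
    rw [hder m (by simpa using hm)]; simp

lemma exists_linear_lower_bound (p : Polynomial ℂ) (hp : p.natDegree ≠ 0) :
    ∃ c > 0, ∃ M : ℝ, ∀ z : ℂ, c * ‖z‖ - M ≤ ‖p.eval z‖ := by
  have hX := Polynomial.divX_mul_X_add p
  have hq0 : p.divX ≠ 0 := by
    intro h
    rw [h, zero_mul, zero_add] at hX
    rw [← hX] at hp
    simp at hp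
  -- the quotient `q = (p - p 0) / X` is bounded away from zero near infinity
  obtain ⟨c, hc, R, hR0, hR⟩ : ∃ c > 0, ∃ R ≥ 0, ∀ z : ℂ, R ≤ ‖z‖ → c ≤ ‖p.divX.eval z‖ := by
    by_cases hd : 0 < p.divX.degree
    · have := (Polynomial.tendsto_norm_atTop p.divX hd
        (tendsto_norm_cobounded_atTop (E := ℂ))).eventually_ge_atTop 1
      obtain ⟨R, -, hR⟩ := (Filter.HasBasis.cobounded_of_norm (E := ℂ) atTop_basis).eventually_iff.1 this
      exact ⟨1, one_pos, max R 0 + 1, by positivity, fun z hz => hR (by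
        have := le_max_left R 0
        simp; linarith)⟩
    · have := Polynomial.eq_C_of_degree_le_zero (not_lt.1 hd)
      refine ⟨‖p.divX.coeff 0‖, ?_, 0, le_rfl, fun z _ => ?_⟩
      · rw [gt_iff_lt, norm_pos_iff]
        intro h
        rw [h] at this
        exact hq0 (by simpa using this)
      · rw [this]; simp
  refine ⟨c, hc, ‖p.coeff 0‖ + c * R, fun z => ?_⟩
  by_cases hz : R ≤ ‖z‖
  · have h1 : p.eval z = p.divX.eval z * z + p.coeff 0 := by
      conv_lhs => rw [← hX]
      simp
    have h2 := norm_sub_le_norm_add (p.divX.eval z * z) (p.coeff 0)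
    rw [← h1, norm_mul] at h2
    have h3 := mul_le_mul_of_nonneg_right (hR z hz) (norm_nonneg z)
    have h4 : 0 ≤ c * R := by positivity
    linarith
  · have h1 : c * ‖z‖ ≤ c * R := mul_le_mul_of_nonneg_left (not_le.1 hz).le hc.le
    have := norm_nonneg (p.eval z)
    have := norm_nonneg (p.coeff 0)
    linarith

lemma norm_mul_cos_le_re {z : ℂ} {ϖ : ℝ} (hϖ : ϖ < Real.pi / 2) (hz : z ∈ sector ϖ) :
    0 < Real.cos ϖ ∧ Real.cos ϖ * ‖z‖ ≤ z.re := by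
  have hz' : |z.arg| ≤ ϖ := hz
  have h0 : 0 ≤ ϖ := (abs_nonneg _).trans hz'
  refine ⟨Real.cos_pos_of_mem_Ioo ⟨by linarith [Real.pi_pos], hϖ⟩, ?_⟩
  rw [← Complex.norm_mul_cos_arg z, mul_comm, ← Real.cos_abs z.arg]
  gcongr
  exact Real.cos_le_cos_of_nonneg_of_le_pi (abs_nonneg _) (by linarith [Real.pi_pos]) hz'

/-- An entire nonconstant function `φ` of order less than `1 / 2` which maps a sector near infinity
into a sector of semi-angle `ϖ < π / 2` is a nonconstant polynomial, so that `Re φ z` is at least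
`c * ‖z‖ - M` on the closed sector. -/
theorem exists_linear_lower_bound_re {φ : ℂ → ℂ} (hφ : Differentiable ℂ φ)
    (hφc : ¬ ∃ c : ℂ, ∀ z : ℂ, φ z = c) (hord : entireOrder φ < ((1 / 2 : ℝ) : EReal))
    {ϖ : ℝ} (hϖ : ϖ < Real.pi / 2) {r α R₀ : ℝ} (hα0 : 0 < α) (hα : α < Real.pi)
    (hmap : ∀ z ∈ contourInterior r α, R₀ < ‖z‖ → φ z ∈ sector ϖ) :
    ∃ c > 0, ∃ M : ℝ, ∀ s : ℝ, 0 ≤ s → ∀ x ∈ Set.Icc (-α) α,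
      c * s - M ≤ (φ (s * Complex.exp (x * Complex.I))).re := by
  set R := max r R₀
  have hS : ∀ z : ℂ, R < ‖z‖ → |z.arg| < α → φ z ∈ sector ϖ := fun z hz hz' =>
    hmap z ⟨(le_max_left _ _).trans_lt hz, hz'⟩ ((le_max_right _ _).trans_lt hz)
  obtain ⟨N, A, hA0, hA⟩ := exists_pow_bound_on_ray hφ hα0 fun z hz hz' => by
    obtain ⟨h1, h2⟩ := norm_mul_cos_le_re hϖ (hS z hz hz')
    exact (by positivity : 0 ≤ Real.cos ϖ * ‖φ z‖).trans h2
  obtain ⟨k, hk0, hk, R₁, hR₁⟩ := exists_exponent_of_entireOrder_lt hφ.continuous hord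
  obtain ⟨p, hp⟩ := exists_polynomial_of_pow_bound hφ
    (exists_pow_bound_of_ray hφ hk0 hk hR₁ hA0 hA)
  have hdeg : p.natDegree ≠ 0 := fun h => hφc ⟨p.coeff 0, fun z => by
    rw [hp, Polynomial.eq_C_of_natDegree_eq_zero h]; simp⟩
  obtain ⟨c, hc, M, hM⟩ := exists_linear_lower_bound p hdeg
  -- `0 ≤ ϖ`, hence `0 < cos ϖ`, because the sector of semi-angle `ϖ` is not empty
  have hcos : 0 < Real.cos ϖ := by
    refine (norm_mul_cos_le_re hϖ (hS ((|R| + 1 : ℝ) : ℂ) ?_ ?_)).1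
    · rw [Complex.norm_real, Real.norm_of_nonneg (by positivity)]
      linarith [le_abs_self R]
    · rw [Complex.arg_ofReal_of_nonneg (by positivity)]; simpa
  obtain ⟨C, hC⟩ := (isCompact_closedBall (0 : ℂ) |R|).exists_bound_of_continuousOn
    hφ.continuous.continuousOn
  refine ⟨Real.cos ϖ * c, by positivity, Real.cos ϖ * |M| + |C| + Real.cos ϖ * c * |R|,
    fun s hs x hx => ?_⟩
  by_cases hsR : s ≤ |R|
  · have h1 : ‖φ (s * Complex.exp (x * Complex.I))‖ ≤ C := by
      apply hC
      simp [Complex.norm_exp_ofReal_mul_I, abs_of_nonneg hs, hsR]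
    have h2 := (abs_le.1 (Complex.abs_re_le_norm (φ (s * Complex.exp (x * Complex.I))))).1
    have h3 : Real.cos ϖ * c * s ≤ Real.cos ϖ * c * |R| := by gcongr
    have h4 : 0 ≤ Real.cos ϖ * |M| := by positivity
    linarith [le_abs_self C]
  · have hsR' : R < s := (le_abs_self R).trans_lt (not_le.1 hsR)
    have hs0 : 0 < s := (abs_nonneg R).trans_lt (not_le.1 hsR)
    -- the bound in the open sector extends to the rays by continuity
    have hcl : x ∈ closure (Set.Ioo (-α) α) := by rwa [closure_Ioo (by linarith)]
    have hclosed : IsClosed {x : ℝ | Real.cos ϖ * ‖φ (s * Complex.exp (x * Complex.I))‖ ≤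
        (φ (s * Complex.exp (x * Complex.I))).re} := by
      have := hφ.continuous
      exact isClosed_le (by fun_prop) (Complex.continuous_re.comp (by fun_prop))
    have hx' := closure_minimal (fun y hy => ?_) hclosed hcl
    · have h1 := hM (s * Complex.exp (x * Complex.I))
      rw [← hp, norm_mul, Complex.norm_exp_ofReal_mul_I, mul_one, Complex.norm_real,
        Real.norm_of_nonneg hs] at h1
      have h2 : Real.cos ϖ * (c * s - |M|) ≤ (φ (s * Complex.exp (x * Complex.I))).re :=
        le_trans (by gcongr; linarith [le_abs_self M]) hx'
      have h3 : 0 ≤ Real.cos ϖ * c * |R| := by positivity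
      linarith [abs_nonneg C]
    · refine (norm_mul_cos_le_re hϖ (hS _ ?_ ?_)).2
      · rwa [norm_mul, Complex.norm_exp_ofReal_mul_I, mul_one, Complex.norm_real,
          Real.norm_of_nonneg hs]
      · rw [Complex.exp_mul_I, Complex.arg_mul_cos_add_sin_mul_I hs0
          ⟨by linarith [hy.1], by linarith [hy.2]⟩]
        exact abs_lt.2 hy

end AbelLidskii

/-! ### The resolvent outside the sector of the numerical range -/

namespace AbelLidskii

lemma cos_le_cos_of_mem_Icc {x ς : ℝ} (hς : 0 ≤ ς) (hx : x ∈ Set.Icc ς (2 * Real.pi - ς)) :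
    Real.cos x ≤ Real.cos ς := by
  rcases le_total x Real.pi with h | h
  · exact Real.cos_le_cos_of_nonneg_of_le_pi hς h hx.1
  · rw [← Real.cos_two_pi_sub x]
    exact Real.cos_le_cos_of_nonneg_of_le_pi hς (by linarith) (by linarith [hx.2])

/-- For `w` in the sector and `z = s * exp (x * I)` with `x` at a distance at least `ς` from the
arguments of the inverses of the points of the sector, `z * w` has an argument `β` with
`cos β ≤ cos ς`, and a ray of argument `β` keeps a distance at least `sin ς` from `1`. -/
lemma sin_le_norm_one_sub {θ ς : ℝ} (hς : 0 < ς) {s x : ℝ} (hs : 0 ≤ s)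
    (hx : x ∈ Set.Icc (θ + ς) (2 * Real.pi - (θ + ς))) {w : ℂ} (hw : w ∈ sector θ) :
    Real.sin ς ≤ ‖1 - s * Complex.exp (x * Complex.I) * w‖ := by
  have hw' := abs_le.1 (show |w.arg| ≤ θ from hw)
  have hcos : Real.cos (x + w.arg) ≤ Real.cos ς :=
    cos_le_cos_of_mem_Icc hς.le ⟨by linarith [hx.1], by linarith [hx.2]⟩
  have hpolar : s * Complex.exp (x * Complex.I) * w =
      ((s * ‖w‖ : ℝ) : ℂ) * Complex.exp ((x + w.arg : ℝ) * Complex.I) := by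
    conv_lhs => rw [← Complex.norm_mul_exp_arg_mul_I w]
    push_cast
    rw [add_mul, Complex.exp_add]
    ring
  refine (le_abs_self _).trans (abs_le_of_sq_le_sq ?_ (norm_nonneg _))
  rw [hpolar, Complex.sq_norm, Complex.normSq_apply, Complex.exp_mul_I, ← Complex.ofReal_cos,
    ← Complex.ofReal_sin]
  simp only [Complex.sub_re, Complex.one_re, Complex.re_ofReal_mul, Complex.add_re,
    Complex.ofReal_re, Complex.mul_I_re, Complex.ofReal_im, Complex.sub_im, Complex.one_im,
    Complex.im_ofReal_mul, Complex.add_im, Complex.mul_I_im, neg_zero, add_zero, zero_add]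
  have hρ : 0 ≤ s * ‖w‖ := by positivity
  set ρ := s * ‖w‖
  calc Real.sin ς ^ 2 = 1 - Real.cos ς ^ 2 := Real.sin_sq ς
    _ ≤ 1 - 2 * (ρ * Real.cos ς) + ρ ^ 2 := by nlinarith [sq_nonneg (ρ - Real.cos ς)]
    _ ≤ 1 - 2 * (ρ * Real.cos (x + w.arg)) + ρ ^ 2 := by
      linarith [mul_le_mul_of_nonneg_left hcos hρ]
    _ = _ := by linear_combination -ρ ^ 2 * Real.sin_sq_add_cos_sq (x + w.arg)

section Resolvent

variable {H : Type*} [NormedAddCommGroup H] [InnerProductSpace ℂ H]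

lemma sin_mul_sq_norm_le_norm_inner {B : H →L[ℂ] H} {θ ς : ℝ}
    (hΘ : numericalRange B ⊆ sector θ) (hς : 0 < ς) {s x : ℝ} (hs : 0 ≤ s)
    (hx : x ∈ Set.Icc (θ + ς) (2 * Real.pi - (θ + ς))) (f : H) :
    ‖f‖ ^ 2 * Real.sin ς ≤
      ‖inner ℂ ((1 - ((s : ℂ) * Complex.exp (x * Complex.I)) • B) f) f‖ := by
  rcases eq_or_ne f 0 with rfl | hf
  · simp
  have hf0 : ‖f‖ ≠ 0 := norm_ne_zero_iff.2 hf
  set e : H := ((‖f‖ : ℂ)⁻¹) • f with he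
  have he1 : ‖e‖ = 1 := by
    rw [he, norm_smul, norm_inv, Complex.norm_real, norm_norm, inv_mul_cancel₀ hf0]
  have hfe : f = (‖f‖ : ℂ) • e := by
    rw [he, smul_smul, mul_inv_cancel₀ (by exact_mod_cast hf0), one_smul]
  set z : ℂ := (s : ℂ) * Complex.exp (x * Complex.I) with hz
  have h1 : ‖inner ℂ ((1 - z • B) e) e‖ = ‖1 - z * inner ℂ e (B e)‖ := by
    rw [norm_inner_symm]
    simp [inner_sub_right, inner_smul_right, he1]
  have h2 := sin_le_norm_one_sub hς hs hx (hΘ ⟨e, he1, rfl⟩)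
  rw [← hz, ← h1] at h2
  have h3 : ‖inner ℂ ((1 - z • B) f) f‖ = ‖f‖ ^ 2 * ‖inner ℂ ((1 - z • B) e) e‖ := by
    conv_lhs => rw [hfe]
    simp only [map_smul, inner_smul_left, inner_smul_right, norm_mul, RCLike.norm_conj,
      Complex.norm_real, norm_norm]
    ring
  rw [h3]
  gcongr

/-- The two-term expansion of the resolvent at infinity: on `B g` the operator
`B (1 - z B)⁻¹` is `-z⁻¹` up to terms of size `‖z‖ ^ (-2)`. -/
lemma resolvent_identity {B : H →L[ℂ] H} {z : ℂ} (hz : z ≠ 0) (hu : IsUnit (1 - z • B)) (g : H) :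
    B (Ring.inverse (1 - z • B) (B g)) + z⁻¹ • B g =
      (z ^ 2)⁻¹ • (Ring.inverse (1 - z • B) g - g) := by
  set T := Ring.inverse (1 - z • B) with hT
  have h1 : ∀ v, T v - z • B (T v) = v := fun v => by
    have := congrArg (fun S : H →L[ℂ] H => S v) (Ring.mul_inverse_cancel _ hu)
    simpa using this
  have h2 : ∀ v, T v - z • T (B v) = v := fun v => by
    have := congrArg (fun S : H →L[ℂ] H => S v) (Ring.inverse_mul_cancel _ hu)
    simpa using this
  have h3 : z • T (B g) = T g - g := by rw [sub_eq_iff_eq_add.1 (h2 g)]; abel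
  have h4 : z • B (T g) = T g - g := by
    rw [eq_sub_iff_add_eq, add_comm, ← eq_sub_iff_add_eq]; exact (h1 g).symm
  have h5 : (z ^ 2) • (B (T (B g)) + z⁻¹ • B g) = T g - g := by
    rw [smul_add, smul_smul, sq, mul_assoc, mul_inv_cancel₀ hz, mul_one, mul_smul, ← map_smul B,
      h3, map_sub, smul_sub, h4]
    abel
  rw [← h5, smul_smul, inv_mul_cancel₀ (pow_ne_zero 2 hz), one_smul]

variable [CompleteSpace H]

lemma isUnit_one_sub_smul {B : H →L[ℂ] H} {θ ς : ℝ}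
    (hΘ : numericalRange B ⊆ sector θ) (hς : 0 < ς) (hςπ : ς < Real.pi) {s x : ℝ} (hs : 0 ≤ s)
    (hx : x ∈ Set.Icc (θ + ς) (2 * Real.pi - (θ + ς))) :
    IsUnit (1 - ((s : ℂ) * Complex.exp (x * Complex.I)) • B) := by
  have hsin : 0 < Real.sin ς := Real.sin_pos_of_pos_of_lt_pi hς hςπ
  exact ContinuousLinearMap.isUnit_of_forall_le_norm_inner_map _ (c := ⟨Real.sin ς, hsin.le⟩)
    hsin (sin_mul_sq_norm_le_norm_inner hΘ hς hs hx)

lemma norm_inverse_one_sub_smul_le {B : H →L[ℂ] H} {θ ς : ℝ}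
    (hΘ : numericalRange B ⊆ sector θ) (hς : 0 < ς) (hςπ : ς < Real.pi) {s x : ℝ} (hs : 0 ≤ s)
    (hx : x ∈ Set.Icc (θ + ς) (2 * Real.pi - (θ + ς))) (g : H) :
    ‖Ring.inverse (1 - ((s : ℂ) * Complex.exp (x * Complex.I)) • B) g‖ ≤ ‖g‖ / Real.sin ς := by
  have hsin : 0 < Real.sin ς := Real.sin_pos_of_pos_of_lt_pi hς hςπ
  set T := 1 - ((s : ℂ) * Complex.exp (x * Complex.I)) • B with hT
  set v := Ring.inverse T g with hv
  have hTv : T v = g := by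
    rw [hv, ← mul_apply_eq_comp,
      Ring.mul_inverse_cancel _ (isUnit_one_sub_smul hΘ hς hςπ hs hx)]
    rfl
  have h1 := sin_mul_sq_norm_le_norm_inner hΘ hς hs hx v
  rw [← hT, hTv] at h1
  have h2 := h1.trans (norm_inner_le_norm g v)
  rw [le_div_iff₀ hsin]
  rcases (norm_nonneg v).eq_or_lt with h | h
  · rw [← h]; simp
  · refine le_of_mul_le_mul_right ?_ h
    linarith

lemma differentiableAt_resolvent {B : H →L[ℂ] H} {z : ℂ} (hu : IsUnit (1 - z • B)) (f : H) :
    DifferentiableAt ℂ (fun z : ℂ => B (Ring.inverse (1 - z • B) f)) z := by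
  have h1 : DifferentiableAt ℂ (fun z : ℂ => (1 - z • B : H →L[ℂ] H)) z := by fun_prop
  have h2 : DifferentiableAt ℂ (fun z : ℂ => Ring.inverse (1 - z • B : H →L[ℂ] H)) z :=
    DifferentiableAt.inverse h1 hu
  exact B.differentiableAt.comp z (h2.clm_apply (differentiableAt_const f))

end Resolvent

end AbelLidskii

/-! ### Integrals over the contour -/

namespace AbelLidskii

open MeasureTheory

section Contour

variable {E : Type*} [NormedAddCommGroup E]

/-- Integrability of `F` on the two rays and on the arc of `contour r α`, in the parametrization of
`truncatedContourIntegral`. -/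
structure ContourIntegrable (r α : ℝ) (F : ℂ → E) : Prop where
  lower : IntegrableOn (fun s : ℝ => F (s * Complex.exp ((-α : ℝ) * Complex.I))) (Set.Ioi r)
  arc : IntervalIntegrable (fun x : ℝ => F (r * Complex.exp (x * Complex.I))) volume (-α) α
  upper : IntegrableOn (fun s : ℝ => F (s * Complex.exp (α * Complex.I))) (Set.Ioi r)

lemma ContourIntegrable.of_bound {r α C : ℝ} (hr : 0 < r) {F : ℂ → E} (hα : 0 ≤ α)
    (hlow : ∀ s : ℝ, r ≤ s → ContinuousAt F (s * Complex.exp ((-α : ℝ) * Complex.I)))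
    (harc : ∀ x ∈ Set.Icc (-α) α, ContinuousAt F (r * Complex.exp (x * Complex.I)))
    (hupp : ∀ s : ℝ, r ≤ s → ContinuousAt F (s * Complex.exp (α * Complex.I)))
    (hlow' : ∀ s : ℝ, r ≤ s → ‖F (s * Complex.exp ((-α : ℝ) * Complex.I))‖ ≤ C * s ^ (-2 : ℝ))
    (hupp' : ∀ s : ℝ, r ≤ s → ‖F (s * Complex.exp (α * Complex.I))‖ ≤ C * s ^ (-2 : ℝ)) :
    ContourIntegrable r α F := by
  have aux : ∀ x : ℝ, (∀ s : ℝ, r ≤ s → ContinuousAt F (s * Complex.exp (x * Complex.I))) →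
      (∀ s : ℝ, r ≤ s → ‖F (s * Complex.exp (x * Complex.I))‖ ≤ C * s ^ (-2 : ℝ)) →
      IntegrableOn (fun s : ℝ => F (s * Complex.exp (x * Complex.I))) (Set.Ioi r) := by
    intro x h1 h2
    refine Integrable.mono' ((integrableOn_Ioi_rpow_of_lt (by norm_num : (-2 : ℝ) < -1)
      hr).const_mul C) ?_ ?_
    · refine ContinuousOn.aestronglyMeasurable (fun s hs => ?_) measurableSet_Ioi
      exact (ContinuousAt.comp (f := fun s : ℝ => (s : ℂ) * Complex.exp (x * Complex.I))
        (h1 s (le_of_lt hs)) (by fun_prop)).continuousWithinAt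
    · exact (ae_restrict_iff' measurableSet_Ioi).2 (Eventually.of_forall fun s hs =>
        h2 s (le_of_lt hs))
  refine ⟨aux _ hlow hlow', ContinuousOn.intervalIntegrable fun x hx => ?_, aux _ hupp hupp'⟩
  rw [Set.uIcc_of_le (by linarith)] at hx
  exact (ContinuousAt.comp (f := fun x : ℝ => (r : ℂ) * Complex.exp (x * Complex.I))
    (harc x hx) (by fun_prop)).continuousWithinAt

lemma ContourIntegrable.sub {r α : ℝ} {F G : ℂ → E} (hF : ContourIntegrable r α F)
    (hG : ContourIntegrable r α G) : ContourIntegrable r α (fun z => F z - G z) :=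
  ⟨hF.lower.sub hG.lower, hF.arc.sub hG.arc, hF.upper.sub hG.upper⟩

variable [NormedSpace ℂ E]

/-- The integral of `F` along the segment from `r * exp (x * I)` to `R * exp (x * I)`. -/
noncomputable def rayIntegral (r R x : ℝ) (F : ℂ → E) : E :=
  ∫ s in r..R, Complex.exp (x * Complex.I) • F (s * Complex.exp (x * Complex.I))

/-- The integral of `F` along the arc of radius `R` about `0`, from argument `a` to argument `b`. -/
noncomputable def arcIntegral (R a b : ℝ) (F : ℂ → E) : E :=
  ∫ x in a..b, (R * Complex.exp (x * Complex.I) * Complex.I) • F (R * Complex.exp (x * Complex.I))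

lemma truncatedContourIntegral_eq (r α R₁ R₂ : ℝ) (F : ℂ → E) :
    truncatedContourIntegral r α R₁ R₂ F =
      -rayIntegral r R₁ (-α) F + arcIntegral r (-α) α F + rayIntegral r R₂ α F := by
  unfold truncatedContourIntegral rayIntegral arcIntegral
  rw [← intervalIntegral.integral_symm]
  simp

/-- **Cauchy's theorem** for the annular sector `r ≤ ‖z‖ ≤ R`, `a ≤ arg z ≤ b`, which is the image
of a rectangle under the exponential map. The angles `a`, `b` need not lie in `(-π, π]`. -/
theorem rayIntegral_add_arcIntegral_eq {r R a b : ℝ} (hr : 0 < r) (hR : r ≤ R) (hab : a ≤ b)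
    {F : ℂ → E} (hF : ∀ s : ℝ, r ≤ s → ∀ x ∈ Set.Icc a b,
      DifferentiableAt ℂ F (s * Complex.exp (x * Complex.I))) :
    rayIntegral r R a F + arcIntegral R a b F = arcIntegral r a b F + rayIntegral r R b F := by
  have hR0 : 0 < R := hr.trans_le hR
  have hexp : ∀ u x : ℝ, Complex.exp (u + x * Complex.I) =
      ((Real.exp u : ℝ) : ℂ) * Complex.exp (x * Complex.I) := fun u x => by
    rw [Complex.exp_add, Complex.ofReal_exp]
  have key := Complex.integral_boundary_rect_eq_zero_of_differentiableOn
    (fun ζ => Complex.exp ζ • F (Complex.exp ζ)) (⟨Real.log r, a⟩ : ℂ) (⟨Real.log R, b⟩ : ℂ) (by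
      intro ζ hζ
      rw [Complex.mem_reProdIm] at hζ
      simp only [Set.uIcc_of_le (Real.log_le_log hr hR), Set.uIcc_of_le hab] at hζ
      have h1 : DifferentiableAt ℂ F (Complex.exp ζ) := by
        rw [← Complex.re_add_im ζ, hexp]
        exact hF _ ((Real.log_le_iff_le_exp hr).1 hζ.1.1) _ hζ.2
      exact (Complex.differentiableAt_exp.smul
        (h1.comp ζ Complex.differentiableAt_exp)).differentiableWithinAt)
  have hray : ∀ x ∈ Set.Icc a b, (∫ u in Real.log r..Real.log R,
      Complex.exp (u + x * Complex.I) • F (Complex.exp (u + x * Complex.I))) =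
        rayIntegral r R x F := by
    intro x hx
    have hsub := intervalIntegral.integral_deriv_smul_comp' (a := Real.log r) (b := Real.log R)
      (f := Real.exp) (f' := Real.exp)
      (g := fun s : ℝ => Complex.exp (x * Complex.I) • F (s * Complex.exp (x * Complex.I)))
      (fun u _ => Real.hasDerivAt_exp u) Real.continuous_exp.continuousOn (by
        rintro _ ⟨u, hu, rfl⟩
        rw [Set.uIcc_of_le (Real.log_le_log hr hR)] at hu
        have h1 := (hF _ ((Real.log_le_iff_le_exp hr).1 hu.1) x hx).continuousAt
        have h2 : ContinuousAt (fun s : ℝ => F (s * Complex.exp (x * Complex.I))) (Real.exp u) :=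
          ContinuousAt.comp (f := fun s : ℝ => (s : ℂ) * Complex.exp (x * Complex.I)) h1
            (by fun_prop)
        exact (h2.const_smul _).continuousWithinAt)
    rw [Real.exp_log hr, Real.exp_log hR0] at hsub
    rw [rayIntegral, ← hsub]
    refine intervalIntegral.integral_congr fun u _ => ?_
    simp only [hexp, Function.comp_apply, mul_smul]
    rfl
  have harc : ∀ ρ : ℝ, 0 < ρ → (Complex.I • ∫ y in a..b,
      Complex.exp ((Real.log ρ : ℝ) + y * Complex.I) •
        F (Complex.exp ((Real.log ρ : ℝ) + y * Complex.I))) = arcIntegral ρ a b F := by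
    intro ρ hρ
    rw [arcIntegral, ← intervalIntegral.integral_smul]
    refine intervalIntegral.integral_congr fun u _ => ?_
    simp only [hexp, Real.exp_log hρ, smul_smul]
    congr 1
    ring
  simp only [hray a ⟨le_rfl, hab⟩, hray b ⟨hab, le_rfl⟩, harc r hr, harc R hR0] at key
  rw [← sub_eq_zero, ← key]
  abel

lemma tendsto_arcIntegral_zero {a b r C : ℝ} (hr : 0 < r) {F : ℂ → E} (hab : a ≤ b)
    (hF : ∀ s : ℝ, r ≤ s → ∀ x ∈ Set.Icc a b,
      ‖F (s * Complex.exp (x * Complex.I))‖ ≤ C * s ^ (-2 : ℝ)) :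
    Tendsto (fun R => arcIntegral R a b F) atTop (𝓝 0) := by
  refine squeeze_zero_norm' (a := fun R => (C * |b - a|) / R) ?_
    (tendsto_const_nhds.div_atTop tendsto_id)
  filter_upwards [eventually_ge_atTop r] with R hR
  have hR0 : 0 < R := hr.trans_le hR
  have := intervalIntegral.norm_integral_le_of_norm_le_const (a := a) (b := b) (C := C / R)
    (f := fun x : ℝ => (R * Complex.exp (x * Complex.I) * Complex.I) •
      F (R * Complex.exp (x * Complex.I))) (fun x hx => by
      rw [Set.uIoc_of_le hab] at hx
      have h := hF R hR x ⟨hx.1.le, hx.2⟩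
      rw [norm_smul, norm_mul, norm_mul, Complex.norm_exp_ofReal_mul_I, Complex.norm_I, mul_one,
        mul_one, Complex.norm_real, Real.norm_of_nonneg hR0.le]
      calc R * ‖F (R * Complex.exp (x * Complex.I))‖ ≤ R * (C * R ^ (-2 : ℝ)) := by gcongr
        _ = C / R := by
          rw [Real.rpow_neg hR0.le, Real.rpow_two]; field_simp)
  rw [arcIntegral]
  refine this.trans_eq ?_
  ring

/-- The integral of `F` over the whole of `contour r α`, as a Bochner integral on each of the two
rays. It is meant for `F` with `ContourIntegrable r α F`. -/
noncomputable def contourIntegral (r α : ℝ) (F : ℂ → E) : E :=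
  -(∫ s in Set.Ioi r, Complex.exp ((-α : ℝ) * Complex.I) •
      F (s * Complex.exp ((-α : ℝ) * Complex.I)))
    + arcIntegral r (-α) α F
    + ∫ s in Set.Ioi r, Complex.exp (α * Complex.I) • F (s * Complex.exp (α * Complex.I))

lemma ContourIntegrable.hasContourIntegral {r α : ℝ} {F : ℂ → E}
    (hF : ContourIntegrable r α F) : HasContourIntegral r α F (contourIntegral r α F) := by
  unfold HasContourIntegral
  simp only [truncatedContourIntegral_eq]
  refine ((Tendsto.neg ?_).add tendsto_const_nhds).add ?_
  · exact intervalIntegral_tendsto_integral_Ioi r (hF.lower.smul _) tendsto_fst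
  · exact intervalIntegral_tendsto_integral_Ioi r (hF.upper.smul _) tendsto_snd

lemma ContourIntegrable.tendsto_diag {r α : ℝ} {F : ℂ → E} (hF : ContourIntegrable r α F) :
    Tendsto (fun R => -rayIntegral r R (-α) F + arcIntegral r (-α) α F + rayIntegral r R α F)
      atTop (𝓝 (contourIntegral r α F)) := by
  have h := hF.hasContourIntegral.comp (tendsto_id.prodMk tendsto_id)
  refine h.congr fun R => ?_
  simp [truncatedContourIntegral_eq]

lemma ContourIntegrable.const_smul {r α : ℝ} {F : ℂ → E} (c : ℂ)
    (hF : ContourIntegrable r α F) : ContourIntegrable r α (fun z => c • F z) :=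
  ⟨hF.lower.smul c, hF.arc.smul c, hF.upper.smul c⟩

lemma ContourIntegrable.arc_smul {r α : ℝ} {F : ℂ → E} (hF : ContourIntegrable r α F) :
    IntervalIntegrable (fun x : ℝ => (r * Complex.exp (x * Complex.I) * Complex.I) •
      F (r * Complex.exp (x * Complex.I))) volume (-α) α :=
  hF.arc.continuousOn_smul (by fun_prop)

lemma contourIntegral_sub {r α : ℝ} {F G : ℂ → E} (hF : ContourIntegrable r α F)
    (hG : ContourIntegrable r α G) :
    contourIntegral r α (fun z => F z - G z) = contourIntegral r α F - contourIntegral r α G := by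
  have harc : arcIntegral r (-α) α (fun z => F z - G z) =
      arcIntegral r (-α) α F - arcIntegral r (-α) α G := by
    unfold arcIntegral
    simp only [smul_sub]
    exact intervalIntegral.integral_sub hF.arc_smul hG.arc_smul
  unfold contourIntegral
  simp only [harc, integral_smul, integral_sub hF.lower hG.lower, integral_sub hF.upper hG.upper]
  simp only [smul_sub]
  abel

lemma contourIntegral_const_smul (r α : ℝ) (F : ℂ → E) (c : ℂ) :
    contourIntegral r α (fun z => c • F z) = c • contourIntegral r α F := by
  unfold contourIntegral arcIntegral
  simp only [smul_comm _ c, integral_smul, intervalIntegral.integral_smul, smul_add, smul_neg]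

/-- Dominated convergence on the contour, for bounded factors `e i` tending to `1` pointwise. -/
lemma tendsto_contourIntegral_smul {ι : Type*} {l : Filter ι} [l.IsCountablyGenerated]
    {r α M : ℝ} (hr : 0 ≤ r) (hα : 0 ≤ α) {F : ℂ → E} (hF : ContourIntegrable r α F)
    {e : ι → ℂ → ℂ} (he : ∀ i, Continuous (e i))
    (hM : ∀ᶠ i in l, ∀ s : ℝ, 0 ≤ s → ∀ x ∈ Set.Icc (-α) α,
      ‖e i (s * Complex.exp (x * Complex.I))‖ ≤ M)
    (hlim : ∀ z, Tendsto (fun i => e i z) l (𝓝 1)) :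
    Tendsto (fun i => contourIntegral r α (fun z => e i z • F z)) l
      (𝓝 (contourIntegral r α F)) := by
  have aux : ∀ x ∈ Set.Icc (-α) α,
      IntegrableOn (fun s : ℝ => F (s * Complex.exp (x * Complex.I))) (Set.Ioi r) →
      Tendsto (fun i => ∫ s in Set.Ioi r, Complex.exp (x * Complex.I) •
        (e i (s * Complex.exp (x * Complex.I)) • F (s * Complex.exp (x * Complex.I)))) l
        (𝓝 (∫ s in Set.Ioi r, Complex.exp (x * Complex.I) •
          F (s * Complex.exp (x * Complex.I)))) := by
    intro x hx hint
    refine tendsto_integral_filter_of_dominated_convergence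
      (fun s => M * ‖F (s * Complex.exp (x * Complex.I))‖) ?_ ?_ (hint.norm.const_mul M) ?_
    · refine Eventually.of_forall fun i => ?_
      have h1 : Continuous fun s : ℝ => e i (s * Complex.exp (x * Complex.I)) :=
        (he i).comp (by fun_prop)
      exact (h1.aestronglyMeasurable.smul hint.aestronglyMeasurable).const_smul _
    · filter_upwards [hM] with i hi
      refine (ae_restrict_iff' measurableSet_Ioi).2 (Eventually.of_forall fun s hs => ?_)
      rw [norm_smul, norm_smul, Complex.norm_exp_ofReal_mul_I, one_mul]
      gcongr
      exact hi s (hr.trans (le_of_lt hs)) x hx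
    · refine Eventually.of_forall fun s => ?_
      simpa using ((hlim (s * Complex.exp (x * Complex.I))).smul_const
        (F (s * Complex.exp (x * Complex.I)))).const_smul (Complex.exp (x * Complex.I))
  refine ((aux (-α) ⟨le_rfl, by linarith⟩ hF.lower).neg.add ?_).add
    (aux α ⟨by linarith, le_rfl⟩ hF.upper)
  refine intervalIntegral.tendsto_integral_filter_of_dominated_convergence
    (fun x => M * ‖(r * Complex.exp (x * Complex.I) * Complex.I) •
      F (r * Complex.exp (x * Complex.I))‖) ?_ ?_ (hF.arc_smul.norm.const_mul M) ?_
  · refine Eventually.of_forall fun i => ?_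
    have h1 : Continuous fun x : ℝ => e i (r * Complex.exp (x * Complex.I)) :=
      (he i).comp (by fun_prop)
    have h2 := h1.aestronglyMeasurable.smul hF.arc_smul.aestronglyMeasurable_restrict_uIoc
    refine h2.congr (Eventually.of_forall fun x => ?_)
    exact smul_comm _ _ _
  · filter_upwards [hM] with i hi
    refine Eventually.of_forall fun x hx => ?_
    rw [Set.uIoc_of_le (by linarith)] at hx
    rw [smul_comm, norm_smul]
    gcongr
    exact hi r hr x ⟨hx.1.le, hx.2⟩
  · refine Eventually.of_forall fun x _ => ?_
    simpa using ((hlim (r * Complex.exp (x * Complex.I))).smul_const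
      (F (r * Complex.exp (x * Complex.I)))).const_smul
        (r * Complex.exp (x * Complex.I) * Complex.I)

/-- If `F` is holomorphic on and inside the contour and is `O(‖z‖ ^ (-2))` there, the contour can be
closed in its inside by large arcs. -/
theorem contourIntegral_eq_zero {r α C : ℝ} (hr : 0 < r) (hα : 0 ≤ α) {F : ℂ → E}
    (hF : ContourIntegrable r α F)
    (hd : ∀ s : ℝ, r ≤ s → ∀ x ∈ Set.Icc (-α) α,
      DifferentiableAt ℂ F (s * Complex.exp (x * Complex.I)))
    (hb : ∀ s : ℝ, r ≤ s → ∀ x ∈ Set.Icc (-α) α,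
      ‖F (s * Complex.exp (x * Complex.I))‖ ≤ C * s ^ (-2 : ℝ)) :
    contourIntegral r α F = 0 := by
  refine tendsto_nhds_unique hF.tendsto_diag
    ((tendsto_arcIntegral_zero hr (by linarith) hb).congr' ?_)
  filter_upwards [eventually_ge_atTop r] with R hR
  have := rayIntegral_add_arcIntegral_eq hr hR (by linarith) hd
  rw [add_assoc, ← this]
  abel

lemma exp_two_pi_sub_mul_I (α : ℝ) :
    Complex.exp ((2 * Real.pi - α : ℝ) * Complex.I) = Complex.exp ((-α : ℝ) * Complex.I) := by
  rw [show ((2 * Real.pi - α : ℝ) : ℂ) * Complex.I =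
    ((-α : ℝ) : ℂ) * Complex.I + 2 * Real.pi * Complex.I by push_cast; ring]
  exact Complex.exp_periodic _

/-- If `F` is holomorphic on the rays and between them on the side of the negative half-axis,
outside of the disc of radius `r`, and is `O(‖z‖ ^ (-2))` there, closing the contour on that side by
large arcs turns the integral into one over the circle of radius `r`. -/
theorem contourIntegral_eq_circleIntegral {r α C : ℝ} (hr : 0 < r) (hα : α ≤ Real.pi) {F : ℂ → E}
    (hF : ContourIntegrable r α F)
    (hd : ∀ s : ℝ, r ≤ s → ∀ x ∈ Set.Icc α (2 * Real.pi - α),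
      DifferentiableAt ℂ F (s * Complex.exp (x * Complex.I)))
    (hb : ∀ s : ℝ, r ≤ s → ∀ x ∈ Set.Icc α (2 * Real.pi - α),
      ‖F (s * Complex.exp (x * Complex.I))‖ ≤ C * s ^ (-2 : ℝ)) :
    contourIntegral r α F = ∮ z in C(0, r), F z := by
  have hαπ : α ≤ 2 * Real.pi - α := by linarith
  have harc : IntervalIntegrable (fun x : ℝ => (r * Complex.exp (x * Complex.I) * Complex.I) •
      F (r * Complex.exp (x * Complex.I))) volume α (2 * Real.pi - α) := by
    refine ContinuousOn.intervalIntegrable fun x hx => ?_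
    rw [Set.uIcc_of_le hαπ] at hx
    have h1 : ContinuousAt (fun x : ℝ => F (r * Complex.exp (x * Complex.I))) x :=
      ContinuousAt.comp (f := fun x : ℝ => (r : ℂ) * Complex.exp (x * Complex.I))
        (hd r le_rfl x hx).continuousAt (by fun_prop)
    exact (ContinuousAt.smul (by fun_prop) h1).continuousWithinAt
  -- the arc of the contour and the complementary arc make up the circle
  have hcircle : arcIntegral r (-α) α F + arcIntegral r α (2 * Real.pi - α) F =
      ∮ z in C(0, r), F z := by
    have hper : Function.Periodic (fun x : ℝ => (r * Complex.exp (x * Complex.I) * Complex.I) •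
        F (r * Complex.exp (x * Complex.I))) (2 * Real.pi) := by
      intro x
      have : Complex.exp ((x + 2 * Real.pi : ℝ) * Complex.I) = Complex.exp (x * Complex.I) := by
        rw [show ((x + 2 * Real.pi : ℝ) : ℂ) * Complex.I =
          x * Complex.I + 2 * Real.pi * Complex.I by push_cast; ring]
        exact Complex.exp_periodic _
      simp only [this]
    unfold arcIntegral
    rw [intervalIntegral.integral_add_adjacent_intervals hF.arc_smul harc,
      show 2 * Real.pi - α = -α + 2 * Real.pi by ring, hper.intervalIntegral_add_eq (-α) 0, zero_add]
    simp [circleIntegral, deriv_circleMap, circleMap]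
  have hlim := (tendsto_arcIntegral_zero hr hαπ hb).const_sub (∮ z in C(0, r), F z)
  rw [sub_zero] at hlim
  refine tendsto_nhds_unique hF.tendsto_diag (hlim.congr' ?_)
  filter_upwards [eventually_ge_atTop r] with R hR
  have h1 := rayIntegral_add_arcIntegral_eq hr hR hαπ hd
  have h2 : rayIntegral r R (2 * Real.pi - α) F = rayIntegral r R (-α) F := by
    unfold rayIntegral
    simp only [exp_two_pi_sub_mul_I]
  rw [h2] at h1
  rw [← hcircle, eq_sub_of_add_eq' h1]
  abel

end Contour

end AbelLidskii

/-! ### The inversion formula -/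

namespace AbelLidskii

section Kernel

variable {H : Type*} [NormedAddCommGroup H] [InnerProductSpace ℂ H] [CompleteSpace H]

/-- The function `B (1 - z B)⁻¹ B g + z⁻¹ B g`: the integrand without its exponential factor, freed
from its leading term `-z⁻¹ B g` at infinity. -/
noncomputable def resolventKernel (B : H →L[ℂ] H) (g : H) (z : ℂ) : H :=
  B (Ring.inverse (1 - z • B) (B g)) + z⁻¹ • B g

lemma differentiableAt_resolventKernel {B : H →L[ℂ] H} {z : ℂ} (hz : z ≠ 0)
    (hu : IsUnit (1 - z • B)) (g : H) : DifferentiableAt ℂ (resolventKernel B g) z :=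
  (differentiableAt_resolvent hu _).add ((differentiableAt_inv hz).smul_const _)

lemma mul_exp_ne_zero {s : ℝ} (hs : 0 < s) (x : ℝ) : (s : ℂ) * Complex.exp (x * Complex.I) ≠ 0 :=
  mul_ne_zero (by exact_mod_cast hs.ne') (Complex.exp_ne_zero _)

lemma norm_mul_exp {s : ℝ} (hs : 0 ≤ s) (x : ℝ) :
    ‖(s : ℂ) * Complex.exp (x * Complex.I)‖ = s := by
  rw [norm_mul, Complex.norm_exp_ofReal_mul_I, mul_one, Complex.norm_real, Real.norm_of_nonneg hs]

lemma norm_resolventKernel_le {B : H →L[ℂ] H} {θ ς : ℝ}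
    (hΘ : numericalRange B ⊆ sector θ) (hς : 0 < ς) (hςπ : ς < Real.pi) {s x : ℝ} (hs : 0 < s)
    (hx : x ∈ Set.Icc (θ + ς) (2 * Real.pi - (θ + ς))) (g : H) :
    ‖resolventKernel B g (s * Complex.exp (x * Complex.I))‖ ≤
      (‖g‖ / Real.sin ς + ‖g‖) * s ^ (-2 : ℝ) := by
  rw [resolventKernel, resolvent_identity (mul_exp_ne_zero hs x)
    (isUnit_one_sub_smul hΘ hς hςπ hs.le hx), norm_smul, norm_inv, norm_pow,
    norm_mul_exp hs.le, Real.rpow_neg hs.le, Real.rpow_two, mul_comm]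
  gcongr
  exact (norm_sub_le _ _).trans (by gcongr; exact norm_inverse_one_sub_smul_le hΘ hς hςπ hs.le hx g)

/-- The resolvent is holomorphic in the disc, so that only the pole of `z⁻¹` contributes. -/
lemma circleIntegral_resolventKernel {B : H →L[ℂ] H} {r : ℝ} (hr : 0 < r)
    (hreg : ∀ z : ℂ, ‖z‖ ≤ r → IsUnit (1 - z • B)) (g : H) :
    (∮ z in C(0, r), resolventKernel B g z) = (2 * Real.pi * Complex.I : ℂ) • B g := by
  have hd : ∀ z : ℂ, ‖z‖ ≤ r →
      DifferentiableAt ℂ (fun z : ℂ => B (Ring.inverse (1 - z • B) (B g))) z :=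
    fun z hz => differentiableAt_resolvent (hreg z hz) _
  have h1 : (∮ z in C(0, r), B (Ring.inverse (1 - z • B) (B g))) = 0 :=
    Complex.circleIntegral_eq_zero_of_differentiable_on_off_countable hr.le Set.countable_empty
      (fun z hz => (hd z (by simpa using hz)).continuousAt.continuousWithinAt)
      (fun z hz => hd z (by simpa using (Metric.ball_subset_closedBall hz.1)))
  have h2 : (∮ z in C(0, r), z⁻¹ • B g) = (2 * Real.pi * Complex.I : ℂ) • B g := by
    rw [circleIntegral.integral_smul_const]
    congr 1
    simpa using circleIntegral.integral_sub_inv_of_mem_ball (c := 0) (w := 0) (R := r) (by simpa)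
  have i1 : CircleIntegrable (fun z : ℂ => B (Ring.inverse (1 - z • B) (B g))) 0 r :=
    ContinuousOn.circleIntegrable hr.le fun z hz =>
      (hd z (by simpa using (mem_sphere_zero_iff_norm.1 hz).le)).continuousAt.continuousWithinAt
  have i2 : CircleIntegrable (fun z : ℂ => z⁻¹ • B g) 0 r :=
    ContinuousOn.circleIntegrable hr.le fun z hz =>
      ((continuousAt_inv₀ (by
        rintro rfl
        simp at hz
        exact hr.ne hz)).smul continuousAt_const).continuousWithinAt
  have := circleIntegral.integral_add i1 i2
  rw [h1, h2, zero_add] at this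
  exact this

lemma norm_exp_neg_mul_le {c M s t : ℝ} (ht : 0 ≤ t) {w : ℂ} (hw : c * s - M ≤ w.re) :
    ‖Complex.exp (-w * t)‖ ≤ Real.exp (M * t) * Real.exp (-(c * t * s)) := by
  rw [Complex.norm_exp, ← Real.exp_add, Real.exp_le_exp, Complex.re_mul_ofReal, Complex.neg_re]
  nlinarith

/-- The inversion formula for any `φ` whose real part grows at least linearly in the closed sector.
With `e = exp (-φ z * t)` and `K` the resolvent kernel, the integrand is `e • K - e • z⁻¹ • B g`.
The second part has integral `0` for `t > 0`, and the integral of the first tends to that of `K`,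
which is `2 * π * I` times `B g`. -/
theorem exists_hasContourIntegral_tendsto {B : H →L[ℂ] H} {θ ς r c M : ℝ} (hθ0 : 0 ≤ θ)
    (hΘ : numericalRange B ⊆ sector θ) (hς : 0 < ς) (hθς : θ + ς < Real.pi) (hr : 0 < r)
    (hreg : ∀ z : ℂ, ‖z‖ ≤ r → IsUnit (1 - z • B)) {φ : ℂ → ℂ} (hφ : Differentiable ℂ φ)
    (hc : 0 < c) (hM : 0 ≤ M)
    (hlow : ∀ s : ℝ, 0 ≤ s → ∀ x ∈ Set.Icc (-(θ + ς)) (θ + ς),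
      c * s - M ≤ (φ (s * Complex.exp (x * Complex.I))).re) (g : H) :
    ∃ u : ℝ → H,
      (∀ t : ℝ, 0 < t → HasContourIntegral r (θ + ς)
        (fun z : ℂ => (1 / (2 * Real.pi * Complex.I)) •
          (Complex.exp (-φ z * t) • B (Ring.inverse (1 - z • B) (B g)))) (u t)) ∧
      Tendsto u (𝓝[>] 0) (𝓝 (B g)) := by
  set α := θ + ς with hα
  have hα0 : 0 ≤ α := by linarith
  have hςπ : ς < Real.pi := by linarith
  have hsin : 0 < Real.sin ς := Real.sin_pos_of_pos_of_lt_pi hς hςπ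
  have hmemα : α ∈ Set.Icc α (2 * Real.pi - α) := ⟨le_rfl, by linarith⟩
  have hmemα' : 2 * Real.pi - α ∈ Set.Icc α (2 * Real.pi - α) := ⟨by linarith, le_rfl⟩
  have hφc := hφ.continuous
  have hec : ∀ t : ℝ, Continuous fun z => Complex.exp (-φ z * t) := fun t => by fun_prop
  set K := resolventKernel B g with hK
  set C := ‖g‖ / Real.sin ς + ‖g‖ with hC
  have hC0 : 0 ≤ C := by positivity
  have hKd : ∀ s : ℝ, r ≤ s → ∀ x ∈ Set.Icc α (2 * Real.pi - α),
      DifferentiableAt ℂ K (s * Complex.exp (x * Complex.I)) := fun s hs x hx =>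
    differentiableAt_resolventKernel (mul_exp_ne_zero (hr.trans_le hs) x)
      (isUnit_one_sub_smul hΘ hς hςπ (hr.le.trans hs) hx) g
  have hKb : ∀ s : ℝ, r ≤ s → ∀ x ∈ Set.Icc α (2 * Real.pi - α),
      ‖K (s * Complex.exp (x * Complex.I))‖ ≤ C * s ^ (-2 : ℝ) := fun s hs x hx =>
    norm_resolventKernel_le hΘ hς hςπ (hr.trans_le hs) hx g
  have hKarc : ∀ x : ℝ, ContinuousAt K (r * Complex.exp (x * Complex.I)) := fun x =>
    (differentiableAt_resolventKernel (mul_exp_ne_zero hr x)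
      (hreg _ (norm_mul_exp hr.le x).le) g).continuousAt
  have hKi : ContourIntegrable r α K := by
    refine .of_bound (C := C) hr hα0 (fun s hs => ?_) (fun x _ => hKarc x)
      (fun s hs => (hKd s hs α hmemα).continuousAt) (fun s hs => ?_)
      (fun s hs => hKb s hs α hmemα)
    · rw [← exp_two_pi_sub_mul_I]
      exact (hKd s hs _ hmemα').continuousAt
    · rw [← exp_two_pi_sub_mul_I]
      exact hKb s hs _ hmemα'
  have hKJ : contourIntegral r α K = (2 * Real.pi * Complex.I : ℂ) • B g := by
    rw [contourIntegral_eq_circleIntegral hr hθς.le hKi hKd hKb,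
      circleIntegral_resolventKernel hr hreg]
  have hexp : ∀ t : ℝ, 0 ≤ t → ∀ s : ℝ, 0 ≤ s → ∀ x ∈ Set.Icc (-α) α,
      ‖Complex.exp (-φ (s * Complex.exp (x * Complex.I)) * t)‖ ≤ Real.exp (M * t) :=
    fun t ht s hs x hx => (norm_exp_neg_mul_le ht (hlow s hs x hx)).trans
      (mul_le_of_le_one_right (Real.exp_pos _).le (Real.exp_le_one_iff.2 (by
        have : 0 ≤ c * t * s := by positivity
        linarith)))
  have hKti : ∀ t : ℝ, 0 < t →
      ContourIntegrable r α fun z => Complex.exp (-φ z * t) • K z := by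
    intro t ht
    have hb : ∀ s : ℝ, r ≤ s → ∀ x ∈ Set.Icc (-α) α,
        ‖K (s * Complex.exp (x * Complex.I))‖ ≤ C * s ^ (-2 : ℝ) →
        ‖Complex.exp (-φ (s * Complex.exp (x * Complex.I)) * t) •
          K (s * Complex.exp (x * Complex.I))‖ ≤ (Real.exp (M * t) * C) * s ^ (-2 : ℝ) := by
      intro s hs x hx h
      rw [norm_smul, mul_assoc]
      gcongr
      exact hexp t ht.le s (hr.le.trans hs) x hx
    refine .of_bound (C := Real.exp (M * t) * C) hr hα0 (fun s hs => ?_)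
      (fun x _ => (hec t).continuousAt.smul (hKarc x))
      (fun s hs => (hec t).continuousAt.smul (hKd s hs α hmemα).continuousAt)
      (fun s hs => hb s hs _ ⟨le_rfl, by linarith⟩ ?_)
      (fun s hs => hb s hs _ ⟨by linarith, le_rfl⟩ (hKb s hs α hmemα))
    · rw [← exp_two_pi_sub_mul_I]
      exact (hec t).continuousAt.smul (hKd s hs _ hmemα').continuousAt
    · rw [← exp_two_pi_sub_mul_I]
      exact hKb s hs _ hmemα'
  have hLb : ∀ t : ℝ, 0 < t → ∀ s : ℝ, r ≤ s → ∀ x ∈ Set.Icc (-α) α,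
      ‖Complex.exp (-φ (s * Complex.exp (x * Complex.I)) * t) •
        ((s : ℂ) * Complex.exp (x * Complex.I))⁻¹ • B g‖ ≤
          (Real.exp (M * t) * (c * t)⁻¹ * ‖B g‖) * s ^ (-2 : ℝ) := by
    intro t ht s hs x hx
    have hs0 : 0 < s := hr.trans_le hs
    have hy : 0 < c * t * s := by positivity
    rw [norm_smul, norm_smul, norm_inv, norm_mul_exp hs0.le, Real.rpow_neg hs0.le, Real.rpow_two]
    -- the exponential decay is only needed through `exp (-y) ≤ y⁻¹`
    have h1 : Real.exp (-(c * t * s)) ≤ (c * t * s)⁻¹ := by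
      rw [Real.exp_neg]
      exact inv_anti₀ hy (by linarith [Real.add_one_le_exp (c * t * s)])
    calc ‖Complex.exp (-φ (s * Complex.exp (x * Complex.I)) * t)‖ * (s⁻¹ * ‖B g‖)
        ≤ (Real.exp (M * t) * (c * t * s)⁻¹) * (s⁻¹ * ‖B g‖) := by
          gcongr
          exact (norm_exp_neg_mul_le ht.le (hlow s hs0.le x hx)).trans (by gcongr)
      _ = _ := by rw [mul_inv, sq, mul_inv]; ring
  have hLd : ∀ t : ℝ, ∀ s : ℝ, r ≤ s → ∀ x : ℝ,
      DifferentiableAt ℂ (fun z : ℂ => Complex.exp (-φ z * t) • z⁻¹ • B g)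
        (s * Complex.exp (x * Complex.I)) := by
    intro t s hs x
    have h1 : Differentiable ℂ fun z => Complex.exp (-φ z * t) := by fun_prop
    exact (h1 _).smul ((differentiableAt_inv (mul_exp_ne_zero (hr.trans_le hs) x)).smul_const _)
  have hLi : ∀ t : ℝ, 0 < t →
      ContourIntegrable r α fun z : ℂ => Complex.exp (-φ z * t) • z⁻¹ • B g := fun t ht =>
    .of_bound hr hα0 (fun s hs => (hLd t s hs _).continuousAt)
      (fun x _ => (hLd t r le_rfl x).continuousAt) (fun s hs => (hLd t s hs _).continuousAt)
      (fun s hs => hLb t ht s hs _ ⟨le_rfl, by linarith⟩)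
      (fun s hs => hLb t ht s hs _ ⟨by linarith, le_rfl⟩)
  have hLJ : ∀ t : ℝ, 0 < t →
      contourIntegral r α (fun z : ℂ => Complex.exp (-φ z * t) • z⁻¹ • B g) = 0 := fun t ht =>
    contourIntegral_eq_zero hr hα0 (hLi t ht) (fun s hs x _ => hLd t s hs x) (hLb t ht)
  refine ⟨fun t => (1 / (2 * Real.pi * Complex.I) : ℂ) •
    contourIntegral r α fun z => Complex.exp (-φ z * t) • K z, fun t ht => ?_, ?_⟩
  · have h := (((hKti t ht).sub (hLi t ht)).const_smul
      (1 / (2 * Real.pi * Complex.I) : ℂ)).hasContourIntegral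
    rw [contourIntegral_const_smul, contourIntegral_sub (hKti t ht) (hLi t ht), hLJ t ht,
      sub_zero] at h
    convert h using 4 with z
    rw [← smul_sub, hK, resolventKernel, add_sub_cancel_right]
  · have hlim := tendsto_contourIntegral_smul (l := 𝓝[>] (0 : ℝ)) (M := Real.exp M) hr.le hα0 hKi
      (e := fun t z => Complex.exp (-φ z * t)) hec ?_ ?_
    · have h2 := hlim.const_smul (1 / (2 * Real.pi * Complex.I) : ℂ)
      rw [hKJ, smul_smul, one_div, inv_mul_cancel₀ Complex.two_pi_I_ne_zero, one_smul] at h2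
      simpa only [one_div] using h2
    · filter_upwards [Ioc_mem_nhdsGT one_pos] with t ht s hs x hx
      refine (hexp t ht.1.le s hs x hx).trans (Real.exp_le_exp.2 ?_)
      exact mul_le_of_le_one_right hM ht.2
    · intro z
      have h : Continuous fun t : ℝ => Complex.exp (-φ z * t) := by fun_prop
      have := (h.tendsto 0).mono_left (nhdsWithin_le_nhds (s := Set.Ioi 0))
      simpa using this

lemma isUnit_of_mem_contour {B : H →L[ℂ] H} {θ ς r : ℝ} (hθ0 : 0 ≤ θ)
    (hΘ : numericalRange B ⊆ sector θ) (hς : 0 < ς) (hθς : θ + ς < Real.pi)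
    (hreg : ∀ z : ℂ, ‖z‖ ≤ r → IsUnit (1 - z • B)) {z : ℂ} (hz : z ∈ contour r (θ + ς)) :
    IsUnit (1 - z • B) := by
  rcases hz with ⟨hz, -⟩ | ⟨-, hz⟩
  · exact hreg z hz.le
  · have hςπ : ς < Real.pi := by linarith
    rw [← Complex.norm_mul_exp_arg_mul_I z]
    rcases abs_choice z.arg with h | h
    · exact isUnit_one_sub_smul hΘ hς hςπ (norm_nonneg z)
        ⟨by rw [← hz, h], by rw [← h, hz]; linarith⟩
    · have harg : z.arg = -(θ + ς) := by linarith
      rw [harg, ← exp_two_pi_sub_mul_I]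
      exact isUnit_one_sub_smul hΘ hς hςπ (norm_nonneg z) ⟨by linarith, le_rfl⟩

end Kernel

end AbelLidskii

theorem lemma4 {H : Type*} [NormedAddCommGroup H] [InnerProductSpace ℂ H] [CompleteSpace H]
    (B : H →L[ℂ] H) (hB : IsCompactOperator B)
    (θ : ℝ) (hθ0 : 0 ≤ θ) (hθ : θ < Real.pi)
    (hΘ : AbelLidskii.numericalRange B ⊆ AbelLidskii.sector θ)
    (ς : ℝ) (hς : 0 < ς) (hθς : θ + ς < Real.pi)
    (r : ℝ) (hr : 0 < r)
    (hreg : ∀ z : ℂ, ‖z‖ ≤ r → IsUnit (1 - z • B))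
    (φ : ℂ → ℂ) (hφ : Differentiable ℂ φ) (hφc : ¬ ∃ c : ℂ, ∀ z : ℂ, φ z = c)
    (hord : AbelLidskii.entireOrder φ < ((1 / 2 : ℝ) : EReal))
    (ϖ : ℝ) (hϖ : ϖ < Real.pi / 2)
    (hmap : ∃ R₀ : ℝ, ∀ z ∈ AbelLidskii.contourInterior r (θ + ς), R₀ < ‖z‖ →
      φ z ∈ AbelLidskii.sector ϖ) :
    (∀ z ∈ AbelLidskii.contour r (θ + ς), IsUnit (1 - z • B)) ∧
      ∀ f ∈ Set.range B, ∃ u : ℝ → H,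
        (∀ t : ℝ, 0 < t →
          AbelLidskii.HasContourIntegral r (θ + ς)
            (fun z : ℂ => (1 / (2 * Real.pi * Complex.I)) •
              (Complex.exp (-φ z * t) • B (Ring.inverse (1 - z • B) f)))
            (u t)) ∧
        Tendsto u (𝓝[>] 0) (𝓝 f) := by

  refine ⟨fun z hz => AbelLidskii.isUnit_of_mem_contour hθ0 hΘ hς hθς hreg hz, ?_⟩
  rintro _ ⟨g, rfl⟩
  obtain ⟨R₀, hR₀⟩ := hmap
  obtain ⟨c, hc, M, hM⟩ := AbelLidskii.exists_linear_lower_bound_re hφ hφc hord hϖ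
    (by linarith : 0 < θ + ς) hθς hR₀
  exact AbelLidskii.exists_hasContourIntegral_tendsto hθ0 hΘ hς hθς hr hreg hφ hc (abs_nonneg M)
    (fun s hs x hx => (sub_le_sub_left (le_abs_self M) _).trans (hM s hs x hx)) g
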